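/- Let $d\in\mathbb{N}$, let $t\ge 0$ and $\varepsilon\ge 0$ be real, and let $\rho\neq\sigma$ be two $d$-dimensional quantum states (density matrices). For a $d$-dimensional state $\kappa$ let $\mathcal{U}_{\kappa,t}(X)=e^{-i\kappa t}Xe^{i\kappa t}$ be the ideal unitary channel, and let $\tfrac12\|\mathcal{N}-\mathcal{M}\|_\diamond=\sup_{R,\omega}\tfrac12\|(\mathcal{I}_R\otimes\mathcal{N})(\omega)-(\mathcal{I}_R\otimes\mathcal{M})(\omega)\|_1$ be the normalized diamond distance, where the supremum is over all finite-dimensional reference systems $R$ and all states $\omega$ of $R$ and the input system. Let $$m^*=m^*(\rho,\sigma,t)=\inf\Big\{m\in\mathbb{N}:\tfrac12\big\|\mathcal{U}_{\rho,t}^{\otimes m}-\mathcal{U}_{\sigma,t}^{\otimes m}\big\|_\diamond=1\Big\}\in\mathbb{N}\cup\{\infty\}$$ be the zero-error query complexity of distinguishing $\mathcal{U}_{\rho,t}$ from $\mathcal{U}_{\sigma,t}$. Let $n_d^*(t,\varepsilon)\in\mathbb{N}\cup\{\infty\}$ be the sample complexity of sample-based Hamiltonian simulation, i.e. the least $n\in\mathbb{N}$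 for which there is a completely positive trace-preserving map $\mathcal{P}^{(n)}$ such that $$\tfrac12\big\|\mathcal{P}^{(n)}\circ\mathcal{A}_{\kappa^{\otimes n}}-\mathcal{U}_{\kappa,t}\big\|_\diamond\le\varepsilon\qquad\text{for all $d$-dimensional states }\kappa,$$ where $\mathcal{A}_{\kappa^{\otimes n}}(\zeta)=\zeta\otimes\kappa^{\otimes n}$. Let $F(\rho,\sigma)=\|\sqrt\rho\sqrt\sigma\|_1^2$ be the fidelity. (Infima over the empty set are $\infty$.) If $m^*\varepsilon\le\tfrac12$, then $$n_d^*(t,\varepsilon)\;\ge\;\frac{-\ln\!\left[4\,m^*\varepsilon\,(1-m^*\varepsilon)\right]}{m^*\,\left[-\ln F(\rho,\sigma)\right]} .$$ The inequality is between extended real numbers, with the conventions $-\ln 0=\infty$, $x/\infty=0$ for every $x\in[0,\infty]$, $\infty/x=\infty$ for $x\in(0,\infty)$, and $0\cdot\infty=0$. -/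

import Mathlib

open scoped Kronecker ENNReal ComplexOrder

noncomputable section

namespace SampleSim

/-- Density matrices (quantum states) on the Hilbert space with orthonormal basis `ι`. -/
def IsDensityMatrix {ι : Type*} [Fintype ι] (ρ : Matrix ι ι ℂ) : Prop :=
  ρ.PosSemidef ∧ ρ.trace = 1

open scoped MatrixOrder in
/-- The square root of a positive semidefinite matrix. -/
def msqrt {ι : Type*} [Fintype ι] [DecidableEq ι] (A : Matrix ι ι ℂ) : Matrix ι ι ℂ :=
  CFC.sqrt A

/-- The trace norm `‖X‖₁ = Tr √(X X†)`. -/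
def traceNorm {ι : Type*} [Fintype ι] [DecidableEq ι] (X : Matrix ι ι ℂ) : ℝ :=
  (msqrt (X * X.conjTranspose)).trace.re

/-- The (squared) Uhlmann fidelity `F(ρ, σ) = ‖√ρ √σ‖₁²`. -/
def fidelity {ι : Type*} [Fintype ι] [DecidableEq ι] (ρ σ : Matrix ι ι ℂ) : ℝ :=
  traceNorm (msqrt ρ * msqrt σ) ^ 2

/-- `I_R ⊗ Φ`, where the reference system `R` has orthonormal basis `R`: the map `Φ` is applied
to each block of a matrix on `R ⊗ ι`. -/
def idTensor {ι κ : Type*} (R : Type*) (Φ : Matrix ι ι ℂ →ₗ[ℂ] Matrix κ κ ℂ) :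
    Matrix (R × ι) (R × ι) ℂ →ₗ[ℂ] Matrix (R × κ) (R × κ) ℂ where
  toFun X := Matrix.of fun p q => Φ (Matrix.of fun k l => X (p.1, k) (q.1, l)) p.2 q.2
  map_add' X Y := by
    ext p q
    exact congrFun (congrFun (Φ.map_add (Matrix.of fun k l => X (p.1, k) (q.1, l))
      (Matrix.of fun k l => Y (p.1, k) (q.1, l))) p.2) q.2
  map_smul' c X := by
    ext p q
    exact congrFun (congrFun (Φ.map_smul c
      (Matrix.of fun k l => X (p.1, k) (q.1, l))) p.2) q.2

/-- Quantum channels: completely positive trace-preserving linear maps. -/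
def IsChannel {ι κ : Type*} [Fintype ι] [Fintype κ]
    (Φ : Matrix ι ι ℂ →ₗ[ℂ] Matrix κ κ ℂ) : Prop :=
  (∀ (r : ℕ) (X : Matrix (Fin r × ι) (Fin r × ι) ℂ),
      X.PosSemidef → (idTensor (Fin r) Φ X).PosSemidef) ∧
    ∀ X : Matrix ι ι ℂ, (Φ X).trace = X.trace

/-- The normalized diamond distance `½ ‖Φ - Ψ‖_⋄`: the supremum, over all finite-dimensional
reference systems and all states `ω` of reference and input, of
`½ ‖(I ⊗ Φ)(ω) - (I ⊗ Ψ)(ω)‖₁`. -/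
def diamondDist {ι κ : Type*} [Fintype ι] [Fintype κ] [DecidableEq κ]
    (Φ Ψ : Matrix ι ι ℂ →ₗ[ℂ] Matrix κ κ ℂ) : ℝ≥0∞ :=
  ⨆ (r : ℕ) (ω : Matrix (Fin r × ι) (Fin r × ι) ℂ) (_ : IsDensityMatrix ω),
    ENNReal.ofReal ((1 / 2) * traceNorm (idTensor (Fin r) Φ ω - idTensor (Fin r) Ψ ω))

/-- The tensor product `A₁ ⊗ ⋯ ⊗ Aₙ` of matrices, in the product basis `Fin n → ι`. -/
def tensorProd {ι : Type*} {n : ℕ} (A : Fin n → Matrix ι ι ℂ) :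
    Matrix (Fin n → ι) (Fin n → ι) ℂ :=
  Matrix.of fun f g => ∏ k, A k (f k) (g k)

/-- The tensor power `κ^{⊗ n}` of a matrix. -/
def tensorPow {ι : Type*} (κ : Matrix ι ι ℂ) (n : ℕ) : Matrix (Fin n → ι) (Fin n → ι) ℂ :=
  tensorProd fun _ : Fin n => κ

/-- The tensor power `Φ^{⊗ m}` of a linear map on matrices, through its values
`⨂ₖ Φ(|f k⟩⟨g k|)` on the product matrix units. -/
def channelPow {ι κ : Type*} [Fintype ι] [DecidableEq ι]
    (Φ : Matrix ι ι ℂ →ₗ[ℂ] Matrix κ κ ℂ) (m : ℕ) :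
    Matrix (Fin m → ι) (Fin m → ι) ℂ →ₗ[ℂ] Matrix (Fin m → κ) (Fin m → κ) ℂ where
  toFun X := ∑ f, ∑ g, X f g • tensorProd fun k => Φ (Matrix.single (f k) (g k) 1)
  map_add' X Y := by
    simp only [Matrix.add_apply, add_smul, Finset.sum_add_distrib]
  map_smul' c X := by
    simp only [Matrix.smul_apply, smul_eq_mul, mul_smul, Finset.smul_sum, RingHom.id_apply]

/-- `Φ^{⊗ m}` acts on product operators factor by factor. -/
theorem channelPow_tensorProd {ι κ : Type*} [Fintype ι] [DecidableEq ι]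
    (Φ : Matrix ι ι ℂ →ₗ[ℂ] Matrix κ κ ℂ) {m : ℕ} (A : Fin m → Matrix ι ι ℂ) :
    channelPow Φ m (tensorProd A) = tensorProd fun k => Φ (A k) := by
  ext p q
  have h : ∀ k, Φ (A k) (p k) (q k)
      = ∑ x : ι × ι, A k x.1 x.2 * Φ (Matrix.single x.1 x.2 1) (p k) (q k) := by
    intro k
    conv_lhs => rw [Matrix.matrix_eq_sum_single (A k)]
    rw [Fintype.sum_prod_type, map_sum, Matrix.sum_apply]
    refine Finset.sum_congr rfl fun i _ => ?_
    rw [map_sum, Matrix.sum_apply]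
    refine Finset.sum_congr rfl fun j _ => ?_
    have : Matrix.single i j (A k i j) = A k i j • Matrix.single i j (1 : ℂ) := by
      simp
    rw [this, map_smul, Matrix.smul_apply, smul_eq_mul]
  simp only [channelPow, LinearMap.coe_mk, AddHom.coe_mk, tensorProd, Matrix.of_apply,
    Matrix.sum_apply, Matrix.smul_apply, smul_eq_mul, h]
  rw [Finset.prod_univ_sum, ← Fintype.sum_prod_type', Fintype.piFinset_univ]
  refine Fintype.sum_equiv (Equiv.arrowProdEquivProdArrow (Fin m) (fun _ => ι) (fun _ => ι)).symm
    _ _ fun x => ?_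
  rw [← Finset.prod_mul_distrib]
  rfl

/-- The appending channel `ζ ↦ ζ ⊗ τ`. -/
def appendState {ι κ : Type*} (τ : Matrix κ κ ℂ) :
    Matrix ι ι ℂ →ₗ[ℂ] Matrix (ι × κ) (ι × κ) ℂ where
  toFun ζ := ζ ⊗ₖ τ
  map_add' X Y := Matrix.add_kronecker X Y τ
  map_smul' c X := Matrix.smul_kronecker c X τ

/-- The ideal unitary channel `U_{κ,t}(X) = e^{-iκt} X e^{iκt}`. -/
def idealChannel {ι : Type*} [Fintype ι] [DecidableEq ι] (κ : Matrix ι ι ℂ) (t : ℝ) :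
    Matrix ι ι ℂ →ₗ[ℂ] Matrix ι ι ℂ where
  toFun X := NormedSpace.exp ((-(Complex.I * t)) • κ) * X * NormedSpace.exp ((Complex.I * t) • κ)
  map_add' X Y := by rw [mul_add, add_mul]
  map_smul' c X := by rw [mul_smul_comm, smul_mul_assoc, RingHom.id_apply]

/-- The sample complexity `n_d^*(t, ε)`: the least number `n` of program states for which one
channel `P`, independent of the program state, satisfies
`½ ‖P ∘ A_{κ^{⊗ n}} - U_{κ,t}‖_⋄ ≤ ε` for all `d`-dimensional states `κ`
(`⊤` if there is no such `n`). -/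
def sampleComplexity (d : ℕ) (t ε : ℝ) : ℕ∞ :=
  ⨅ (n : ℕ) (_ : ∃ P : Matrix (Fin d × (Fin n → Fin d)) (Fin d × (Fin n → Fin d)) ℂ →ₗ[ℂ]
      Matrix (Fin d) (Fin d) ℂ,
      IsChannel P ∧ ∀ κ : Matrix (Fin d) (Fin d) ℂ, IsDensityMatrix κ →
        diamondDist (P ∘ₗ appendState (tensorPow κ n)) (idealChannel κ t) ≤ ENNReal.ofReal ε),
    (n : ℕ∞)

/-- The zero-error query complexity `m^*(ρ, σ, t)`: the least `m` with
`½ ‖U_{ρ,t}^{⊗ m} - U_{σ,t}^{⊗ m}‖_⋄ = 1` (`⊤` if there is no such `m`). -/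
def zeroErrorQueryComplexity {d : ℕ} (ρ σ : Matrix (Fin d) (Fin d) ℂ) (t : ℝ) : ℕ∞ :=
  ⨅ (m : ℕ) (_ : diamondDist (channelPow (idealChannel ρ t) m)
      (channelPow (idealChannel σ t) m) = 1), (m : ℕ∞)

end SampleSim

end

/-! Suppose `P` simulates every `U_κ` to error `ε` from `n` program copies, and `m` parallel uses of
`U_ρ` and `U_σ` are perfectly distinguishable. Replacing each use by `P` costs at most `ε` (hybrid
argument, `IsEffect.re_sub_applyList_le`), so some effect on the simulated outputs has probability
at least about `1 - mε` for `ρ` and at most about `mε` for `σ`. These outputs depend on the programs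
only through `ρ^{⊗nm}` and `σ^{⊗nm}`, whose fidelity is `F^{nm}`. Fidelity cannot decrease under
processing and measurement, so `F^{nm} ≤ 4mε(1 - mε)` (`fidelity_pow_le`); logarithms give the
bound.

Monotonicity and multiplicativity of fidelity are both obtained from one positive block matrix with
diagonal `σ`, `ρ` and off-diagonal trace `√F` (`exists_blockPSD_trace_eq`). Positivity of the blocks
survives tensor powers and applications of `P`, the off-diagonal trace becomes `√F^{nm}`, and
Cauchy–Schwarz (`BlockPSD.norm_map_le`) for the effect and its complement bounds that trace by the
classical overlap of the two outcome distributions. -/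

noncomputable section

namespace SampleSim

open Matrix

variable {ι κ : Type*} [Fintype ι] [Fintype κ]

/-! ### Functional calculus: pseudo-inverse, polar decomposition, positive part -/

section SpectralLemmas

open scoped MatrixOrder

variable [DecidableEq ι]

theorem msqrt_posSemidef (A : Matrix ι ι ℂ) : (msqrt A).PosSemidef :=
  Matrix.nonneg_iff_posSemidef.mp (CFC.sqrt_nonneg A)

theorem msqrt_mul_self {A : Matrix ι ι ℂ} (hA : A.PosSemidef) : msqrt A * msqrt A = A :=
  CFC.sqrt_mul_sqrt_self A (Matrix.nonneg_iff_posSemidef.mpr hA)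

theorem msqrt_eq_of_mul_self {A B : Matrix ι ι ℂ} (h : B * B = A) (hB : B.PosSemidef) :
    msqrt A = B :=
  CFC.sqrt_unique h (Matrix.nonneg_iff_posSemidef.mpr hB)

theorem continuousOn_real_spectrum (A : Matrix ι ι ℂ) (f : ℝ → ℝ) :
    ContinuousOn f (spectrum ℝ A) :=
  (Matrix.finite_real_spectrum (A := A)).continuousOn f

theorem cfc_mul_matrix (f g : ℝ → ℝ) (A : Matrix ι ι ℂ) :
    cfc f A * cfc g A = cfc (fun x => f x * g x) A :=
  (cfc_mul f g A (continuousOn_real_spectrum A f) (continuousOn_real_spectrum A g)).symm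

/-- A Hermitian matrix has a Hermitian pseudo-inverse commuting with it. -/
theorem exists_pseudoInverse {S : Matrix ι ι ℂ} (hS : S.IsHermitian) :
    ∃ G : Matrix ι ι ℂ, G.IsHermitian ∧ S * S * G = S ∧ G * S * S * G * (G * S * S * G)
      = G * S * S * G := by
  have hid : cfc (fun x : ℝ => x) S = S := cfc_id' ℝ S hS
  -- The convention `0⁻¹ = 0` makes this the pseudo-inverse; continuity is free because the spectrum
  -- is finite.
  refine ⟨cfc (fun x : ℝ => x⁻¹) S, cfc_predicate (R := ℝ) _ S, ?_, ?_⟩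
  · have h : S * S * cfc (fun x : ℝ => x⁻¹) S = cfc (fun x : ℝ => x * x * x⁻¹) S := by
      nth_rewrite 1 2 [← hid]
      rw [cfc_mul_matrix, cfc_mul_matrix]
    rw [h]
    conv_rhs => rw [← hid]
    congr 1
    funext x
    by_cases hx : x = 0
    · simp [hx]
    · field_simp
  · have h : cfc (fun x : ℝ => x⁻¹) S * S * S * cfc (fun x : ℝ => x⁻¹) S
        = cfc (fun x : ℝ => x⁻¹ * x * x * x⁻¹) S := by
      nth_rewrite 2 3 [← hid]
      rw [cfc_mul_matrix, cfc_mul_matrix, cfc_mul_matrix]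
    rw [h, cfc_mul_matrix]
    congr 1
    funext x
    by_cases hx : x = 0
    · simp [hx]
    · field_simp

/-- Polar decomposition: the trace norm of `X` is attained by a partial isometry. -/
theorem exists_partialIsometry_trace (X : Matrix ι ι ℂ) :
    ∃ U : Matrix ι ι ℂ, (X * U).trace = traceNorm X ∧ Uᴴ * U * (Uᴴ * U) = Uᴴ * U := by
  have hS := msqrt_posSemidef (X * Xᴴ)
  have hSS := msqrt_mul_self (Matrix.posSemidef_self_mul_conjTranspose X)
  obtain ⟨G, hG, h1, h2⟩ := exists_pseudoInverse hS.isHermitian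
  refine ⟨Xᴴ * G, ?_, ?_⟩
  · rw [← Matrix.mul_assoc, ← hSS, h1, traceNorm]
    have := hS.trace_nonneg
    rw [Complex.nonneg_iff] at this
    exact Complex.ext rfl (by simpa using this.2.symm)
  · have h : (Xᴴ * G)ᴴ * (Xᴴ * G) = G * msqrt (X * Xᴴ) * msqrt (X * Xᴴ) * G := by
      rw [Matrix.conjTranspose_mul, hG.eq, Matrix.conjTranspose_conjTranspose,
        Matrix.mul_assoc G (msqrt _), hSS]
      simp only [Matrix.mul_assoc]
    rw [h, h2]

/-- The projection onto the positive part of a Hermitian matrix. -/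
theorem exists_positivePart_projection {D : Matrix ι ι ℂ} (hD : D.IsHermitian) :
    (msqrt (D * Dᴴ) + D).PosSemidef ∧ (msqrt (D * Dᴴ) - D).PosSemidef ∧
      ∃ Q : Matrix ι ι ℂ, Q.IsHermitian ∧ Q * Q = Q ∧
        (2 : ℂ) • (Q * D) = msqrt (D * Dᴴ) + D := by
  have hid : cfc (fun x : ℝ => x) D = D := cfc_id' ℝ D hD
  have habs : msqrt (D * Dᴴ) = cfc (fun x : ℝ => |x|) D := by
    apply msqrt_eq_of_mul_self
    · rw [cfc_mul_matrix, hD.eq]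
      nth_rewrite 2 3 [← hid]
      rw [cfc_mul_matrix]
      simp
    · exact Matrix.nonneg_iff_posSemidef.mp (cfc_nonneg fun x _ => abs_nonneg x)
  have hadd : msqrt (D * Dᴴ) + D = cfc (fun x : ℝ => |x| + x) D := by
    rw [cfc_add (R := ℝ) D (fun x => |x|) (fun x => x) (continuousOn_real_spectrum D _)
      (continuousOn_real_spectrum D _), hid, habs]
  have hsub : msqrt (D * Dᴴ) - D = cfc (fun x : ℝ => |x| - x) D := by
    rw [cfc_sub (R := ℝ) (fun x => |x|) (fun x => x) D (continuousOn_real_spectrum D _)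
      (continuousOn_real_spectrum D _), hid, habs]
  refine ⟨?_, ?_, cfc (fun x : ℝ => if 0 < x then 1 else 0) D, cfc_predicate (R := ℝ) _ D, ?_, ?_⟩
  · rw [hadd]
    exact Matrix.nonneg_iff_posSemidef.mp (cfc_nonneg fun x _ => by linarith [neg_abs_le x])
  · rw [hsub]
    exact Matrix.nonneg_iff_posSemidef.mp (cfc_nonneg fun x _ => by linarith [le_abs_self x])
  · rw [cfc_mul_matrix]
    congr 1
    funext x
    split_ifs <;> simp
  · rw [hadd]
    nth_rewrite 2 [← hid]
    rw [cfc_mul_matrix, two_smul, ← cfc_add (R := ℝ) D _ _ (continuousOn_real_spectrum D _)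
      (continuousOn_real_spectrum D _)]
    congr 1
    funext x
    split_ifs with hx
    · rw [abs_of_pos hx]; ring
    · rw [abs_of_nonpos (not_lt.mp hx)]; ring

end SpectralLemmas

/-! ### Effects and the trace norm -/

/-- Linear functionals `φ` with `0 ≤ φ X ≤ Tr X` for positive semidefinite `X`. -/
def IsEffect (φ : Matrix ι ι ℂ →ₗ[ℂ] ℂ) : Prop :=
  ∀ X : Matrix ι ι ℂ, X.PosSemidef → 0 ≤ φ X ∧ φ X ≤ X.trace

/-- Apply the upper bound of the effect to `|D| + D` and its positivity to `|D| - D`; since `D` is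
traceless, adding the two cancels `φ |D|`. -/
theorem IsEffect.re_le_traceNorm [DecidableEq ι] {φ : Matrix ι ι ℂ →ₗ[ℂ] ℂ} (hφ : IsEffect φ)
    {D : Matrix ι ι ℂ} (hD : D.IsHermitian) (htr : D.trace = 0) :
    (φ D).re ≤ 1 / 2 * traceNorm D := by
  obtain ⟨hp, hn, -⟩ := exists_positivePart_projection hD
  have h1 := (Complex.le_def.mp (hφ _ hp).2).1
  have h2 := (Complex.le_def.mp (hφ _ hn).1).1
  rw [map_add, Matrix.trace_add, htr, add_zero, Complex.add_re] at h1
  rw [map_sub, Complex.sub_re, Complex.zero_re] at h2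
  rw [traceNorm]
  linarith

theorem isEffect_of_projection {Q : Matrix ι ι ℂ} (hQ : Q.IsHermitian) (hQQ : Q * Q = Q) :
    IsEffect (Matrix.traceLinearMap ι ℂ ℂ ∘ₗ LinearMap.mulLeft ℂ Q) := by
  classical
  have key : ∀ (P X : Matrix ι ι ℂ), P.IsHermitian → P * P = P → X.PosSemidef →
      0 ≤ (P * X).trace := by
    intro P X hP hPP hX
    have h := (hX.conjTranspose_mul_mul_same P).trace_nonneg
    rwa [hP.eq, Matrix.trace_mul_comm, ← Matrix.mul_assoc, hPP] at h
  intro X hX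
  refine ⟨key Q X hQ hQQ hX, ?_⟩
  have h := key (1 - Q) X (Matrix.isHermitian_one.sub hQ) (by
    simp [Matrix.sub_mul, Matrix.mul_sub, hQQ]) hX
  rw [Matrix.sub_mul, Matrix.one_mul, Matrix.trace_sub] at h
  exact sub_nonneg.mp h

theorem exists_isEffect_re_eq_traceNorm [DecidableEq ι] {D : Matrix ι ι ℂ}
    (hD : D.IsHermitian) (htr : D.trace = 0) :
    ∃ φ : Matrix ι ι ℂ →ₗ[ℂ] ℂ, IsEffect φ ∧ (φ D).re = 1 / 2 * traceNorm D := by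
  obtain ⟨-, -, Q, hQ, hQQ, h⟩ := exists_positivePart_projection hD
  refine ⟨_, isEffect_of_projection hQ hQQ, ?_⟩
  have h' := congrArg (fun M => (Matrix.trace M).re) h
  simp only [Matrix.trace_smul, Matrix.trace_add, htr, add_zero, smul_eq_mul, Complex.mul_re,
    Complex.re_ofNat, Complex.im_ofNat, zero_mul, sub_zero] at h'
  simp only [LinearMap.comp_apply, LinearMap.mulLeft_apply, Matrix.traceLinearMap_apply, traceNorm]
  linarith

/-! ### Positive block matrices and Cauchy–Schwarz -/

/-- A two-by-two family of blocks that forms a positive semidefinite matrix. -/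
def BlockPSD {χ : Type*} (Z : Fin 2 → Fin 2 → Matrix χ χ ℂ) : Prop :=
  (Matrix.of fun x y : Fin 2 × χ => Z x.1 y.1 x.2 y.2).PosSemidef

theorem blockPSD_const {χ : Type*} {ω : Matrix χ χ ℂ} (hω : ω.PosSemidef) :
    BlockPSD fun _ _ => ω :=
  hω.submatrix (Prod.snd : Fin 2 × χ → χ)

/-- A positive functional is automatically completely positive: compressing the blocks by `v` shows
that the scalar matrix `φ (Z a b)` is positive semidefinite, and its determinant is nonnegative. -/
theorem BlockPSD.norm_map_le {φ : Matrix ι ι ℂ →ₗ[ℂ] ℂ}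
    (hφ : ∀ X : Matrix ι ι ℂ, X.PosSemidef → 0 ≤ φ X)
    {Z : Fin 2 → Fin 2 → Matrix ι ι ℂ} (hZ : BlockPSD Z) :
    ‖φ (Z 0 1)‖ ≤ √(φ (Z 0 0)).re * √(φ (Z 1 1)).re := by
  classical
  have hQ : (Matrix.of fun a b => φ (Z a b)).PosSemidef := by
    have hquad : ∀ v : Fin 2 → ℂ, 0 ≤ star v ⬝ᵥ (Matrix.of fun a b => φ (Z a b)) *ᵥ v := by
      intro v
      let V : Matrix (Fin 2 × ι) ι ℂ := Matrix.of fun x j => if x.2 = j then v x.1 else 0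
      have h := hφ _ (hZ.conjTranspose_mul_mul_same V)
      have heq : Vᴴ * (Matrix.of fun x y : Fin 2 × ι => Z x.1 y.1 x.2 y.2) * V
          = ∑ a, ∑ b, (star (v a) * v b) • Z a b := by
        ext i j
        simp only [V, Matrix.mul_apply, Matrix.conjTranspose_apply, Matrix.of_apply,
          Fintype.sum_prod_type, apply_ite star, star_zero, ite_mul, zero_mul, mul_ite, mul_zero,
          Finset.sum_ite_eq', Finset.mem_univ, if_true, Matrix.sum_apply, Matrix.smul_apply,
          smul_eq_mul, Finset.sum_mul]
        rw [Finset.sum_comm]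
        exact Finset.sum_congr rfl fun a _ => Finset.sum_congr rfl fun b _ => by ring
      rw [heq] at h
      refine h.trans_eq ?_
      simp only [map_sum, map_smul, smul_eq_mul, dotProduct, Matrix.mulVec, Matrix.of_apply,
        Finset.mul_sum, Pi.star_apply]
      exact Finset.sum_congr rfl fun a _ => Finset.sum_congr rfl fun b _ => by ring
    -- Polarization: the quadratic form is real at four test vectors, which forces the matrix to be
    -- Hermitian.
    have him := fun v => (Complex.nonneg_iff.mp (hquad v)).2
    have e0 := him ![1, 0]
    have e1 := him ![0, 1]
    have e2 := him ![1, 1]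
    have e3 := him ![1, Complex.I]
    simp [dotProduct, Matrix.mulVec, Fin.sum_univ_two] at e0 e1 e2 e3
    refine .of_dotProduct_mulVec_nonneg ?_ hquad
    ext a b
    fin_cases a <;> fin_cases b <;> apply Complex.ext <;> simp <;> linarith
  have hdet := hQ.det_nonneg
  rw [Matrix.det_fin_two] at hdet
  have h0 := Complex.nonneg_iff.mp (hQ.diag_nonneg (i := 0))
  have h1 := Complex.nonneg_iff.mp (hQ.diag_nonneg (i := 1))
  have h10 := hQ.isHermitian.apply 1 0
  simp only [Matrix.of_apply] at hdet h0 h1 h10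
  rw [← h10] at hdet
  have h := (Complex.nonneg_iff.mp hdet).1
  rw [Complex.sub_re, Complex.mul_re, ← h0.2, ← h1.2, Complex.star_def, Complex.mul_conj,
    Complex.ofReal_re, Complex.normSq_eq_norm_sq] at h
  rw [← Real.sqrt_mul h0.1]
  exact Real.le_sqrt_of_sq_le (by linarith)

/-! ### Channels and effects with an arbitrary finite reference -/

variable {R : Type*} [Fintype R]

theorem IsChannel.idTensor_posSemidef {Φ : Matrix ι ι ℂ →ₗ[ℂ] Matrix κ κ ℂ} (hΦ : IsChannel Φ)
    {X : Matrix (R × ι) (R × ι) ℂ} (hX : X.PosSemidef) : (idTensor R Φ X).PosSemidef := by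
  let e := Fintype.equivFin R
  have h := hΦ.1 _ _ (hX.submatrix (Prod.map e.symm id : Fin (Fintype.card R) × ι → R × ι))
  have h' := h.submatrix (Prod.map e id : R × κ → Fin (Fintype.card R) × κ)
  convert h' using 1
  ext p q
  simp [idTensor]

theorem IsChannel.trace_idTensor {Φ : Matrix ι ι ℂ →ₗ[ℂ] Matrix κ κ ℂ} (hΦ : IsChannel Φ)
    (X : Matrix (R × ι) (R × ι) ℂ) : (idTensor R Φ X).trace = X.trace := by
  simp only [Matrix.trace, Fintype.sum_prod_type, Matrix.diag_apply]
  refine Finset.sum_congr rfl fun r _ => ?_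
  have h := hΦ.2 (Matrix.of fun k l => X (r, k) (r, l))
  simpa [Matrix.trace, idTensor] using h

theorem IsDensityMatrix.submatrix_equiv {ρ : Matrix ι ι ℂ} (hρ : IsDensityMatrix ρ) (e : κ ≃ ι) :
    IsDensityMatrix (ρ.submatrix e e) := by
  refine ⟨hρ.1.submatrix e, ?_⟩
  rw [← hρ.2]
  exact Fintype.sum_equiv e _ _ fun _ => rfl

theorem IsChannel.isDensityMatrix_idTensor {Φ : Matrix ι ι ℂ →ₗ[ℂ] Matrix κ κ ℂ}
    (hΦ : IsChannel Φ) {ω : Matrix (R × ι) (R × ι) ℂ} (hω : IsDensityMatrix ω) :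
    IsDensityMatrix (idTensor R Φ ω) :=
  ⟨hΦ.idTensor_posSemidef hω.1, (hΦ.trace_idTensor ω).trans hω.2⟩

theorem IsEffect.submatrix {φ : Matrix ι ι ℂ →ₗ[ℂ] ℂ} (hφ : IsEffect φ) (e : ι ≃ κ) :
    IsEffect (φ ∘ₗ (Matrix.reindexLinearEquiv ℂ ℂ e.symm e.symm).toLinearMap) := by
  intro X hX
  have h := hφ (X.submatrix e e) (hX.submatrix e)
  have ht : (X.submatrix e e).trace = X.trace := Fintype.sum_equiv e _ _ fun _ => rfl
  rw [ht] at h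
  exact h

/-- If two channels are `ε`-close in diamond distance, no effect on any finite-dimensional
reference and output separates their outputs by more than `ε`. -/
theorem IsEffect.re_sub_le_of_diamondDist_le [DecidableEq κ]
    {Φ Ψ : Matrix ι ι ℂ →ₗ[ℂ] Matrix κ κ ℂ}
    (hΦ : IsChannel Φ) (hΨ : IsChannel Ψ) {ε : ℝ} (hε : 0 ≤ ε)
    (h : diamondDist Φ Ψ ≤ ENNReal.ofReal ε) {φ : Matrix (R × κ) (R × κ) ℂ →ₗ[ℂ] ℂ}
    (hφ : IsEffect φ) {ω : Matrix (R × ι) (R × ι) ℂ} (hω : IsDensityMatrix ω) :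
    |(φ (idTensor R Φ ω - idTensor R Ψ ω)).re| ≤ ε := by
  let e := Fintype.equivFin R
  have hω' := hω.submatrix_equiv (Equiv.prodCongr e.symm (Equiv.refl ι))
  set ω' := ω.submatrix (Equiv.prodCongr e.symm (Equiv.refl ι))
    (Equiv.prodCongr e.symm (Equiv.refl ι)) with hdef
  have hn : (1 / 2) * traceNorm (idTensor (Fin (Fintype.card R)) Φ ω'
      - idTensor (Fin (Fintype.card R)) Ψ ω') ≤ ε := by
    rw [← ENNReal.ofReal_le_ofReal_iff hε]
    refine le_trans ?_ h
    exact le_iSup_of_le _ (le_iSup_of_le ω' (le_iSup_of_le hω' le_rfl))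
  have hA := hΦ.isDensityMatrix_idTensor hω'
  have hB := hΨ.isDensityMatrix_idTensor hω'
  have hφ' := hφ.submatrix (Equiv.prodCongr e (Equiv.refl κ))
  have hval : ∀ Φ : Matrix ι ι ℂ →ₗ[ℂ] Matrix κ κ ℂ,
      (Matrix.reindexLinearEquiv ℂ ℂ (Equiv.prodCongr e (Equiv.refl κ)).symm
        (Equiv.prodCongr e (Equiv.refl κ)).symm) (idTensor _ Φ ω') = idTensor R Φ ω := by
    intro Φ
    ext p q
    simp [idTensor, hdef]
  have h1 := hφ'.re_le_traceNorm (hA.1.isHermitian.sub hB.1.isHermitian)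
    (by rw [Matrix.trace_sub, hA.2, hB.2, sub_self])
  have h2 := hφ'.re_le_traceNorm (hB.1.isHermitian.sub hA.1.isHermitian)
    (by rw [Matrix.trace_sub, hA.2, hB.2, sub_self])
  have hneg : traceNorm (idTensor (Fin (Fintype.card R)) Ψ ω'
      - idTensor (Fin (Fintype.card R)) Φ ω') = traceNorm (idTensor (Fin (Fintype.card R)) Φ ω'
      - idTensor (Fin (Fintype.card R)) Ψ ω') := by
    rw [traceNorm, traceNorm, ← neg_sub, Matrix.conjTranspose_neg, neg_mul_neg]
  rw [hneg] at h2
  simp only [LinearMap.comp_apply, LinearEquiv.coe_coe, map_sub, hval, Complex.sub_re] at h1 h2 ⊢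
  rw [abs_le]
  constructor <;> linarith

/-! ### Channels on single tensor factors and the hybrid argument -/

section Sites

variable {m : ℕ} {S : Type*}

/-- Splitting off the `k`-th tensor factor. -/
def siteEquiv (S ι : Type*) (k : Fin m) :
    S × (Fin m → ι) ≃ (S × ({j // j ≠ k} → ι)) × ι :=
  (Equiv.prodCongr (Equiv.refl S) ((Equiv.funSplitAt k ι).trans (Equiv.prodComm _ _))).trans
    (Equiv.prodAssoc _ _ _).symm

/-- The map `Φ` applied to the `k`-th tensor factor. -/
def applyAt (S : Type*) (k : Fin m) (Φ : Matrix ι ι ℂ →ₗ[ℂ] Matrix ι ι ℂ) :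
    Matrix (S × (Fin m → ι)) (S × (Fin m → ι)) ℂ →ₗ[ℂ]
      Matrix (S × (Fin m → ι)) (S × (Fin m → ι)) ℂ :=
  (Matrix.reindexLinearEquiv ℂ ℂ (siteEquiv S ι k).symm (siteEquiv S ι k).symm).toLinearMap ∘ₗ
    idTensor (S × ({j // j ≠ k} → ι)) Φ ∘ₗ
      (Matrix.reindexLinearEquiv ℂ ℂ (siteEquiv S ι k) (siteEquiv S ι k)).toLinearMap

omit [Fintype ι] in
theorem applyAt_apply (k : Fin m) (Φ : Matrix ι ι ℂ →ₗ[ℂ] Matrix ι ι ℂ)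
    (X : Matrix (S × (Fin m → ι)) (S × (Fin m → ι)) ℂ) :
    applyAt S k Φ X = (idTensor (S × ({j // j ≠ k} → ι)) Φ
      (X.submatrix (siteEquiv S ι k).symm (siteEquiv S ι k).symm)).submatrix
        (siteEquiv S ι k) (siteEquiv S ι k) := rfl

theorem IsChannel.applyAt_posSemidef {Φ : Matrix ι ι ℂ →ₗ[ℂ] Matrix ι ι ℂ} (hΦ : IsChannel Φ)
    (k : Fin m) {X : Matrix (R × (Fin m → ι)) (R × (Fin m → ι)) ℂ} (hX : X.PosSemidef) :
    (applyAt R k Φ X).PosSemidef :=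
  (hΦ.idTensor_posSemidef (hX.submatrix (siteEquiv R ι k).symm)).submatrix (siteEquiv R ι k)

/-- The factor `c` covers maps that are not trace preserving, namely `P` fed with an off-diagonal
program block. -/
theorem trace_applyAt {c : ℂ} {Φ : Matrix ι ι ℂ →ₗ[ℂ] Matrix ι ι ℂ}
    (hΦ : ∀ X, (Φ X).trace = c * X.trace) (k : Fin m)
    (X : Matrix (R × (Fin m → ι)) (R × (Fin m → ι)) ℂ) :
    (applyAt R k Φ X).trace = c * X.trace := by
  have h1 : ∀ Y : Matrix ((R × ({j // j ≠ k} → ι)) × ι) ((R × ({j // j ≠ k} → ι)) × ι) ℂ,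
      (idTensor (R × ({j // j ≠ k} → ι)) Φ Y).trace = c * Y.trace := by
    intro Y
    simp only [Matrix.trace, Fintype.sum_prod_type (α₁ := R × ({j // j ≠ k} → ι)),
      Matrix.diag_apply, Finset.mul_sum]
    refine Finset.sum_congr rfl fun r _ => ?_
    have h := hΦ (Matrix.of fun k l => Y (r, k) (r, l))
    simpa [Matrix.trace, idTensor, Finset.mul_sum] using h
  have h2 : (X.submatrix (siteEquiv R ι k).symm (siteEquiv R ι k).symm).trace = X.trace :=
    Fintype.sum_equiv (siteEquiv R ι k).symm _ _ fun _ => rfl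
  rw [← h2, ← h1, applyAt_apply]
  exact Fintype.sum_equiv (siteEquiv R ι k) _ _ fun _ => rfl

theorem IsChannel.isDensityMatrix_applyAt {Φ : Matrix ι ι ℂ →ₗ[ℂ] Matrix ι ι ℂ}
    (hΦ : IsChannel Φ) (k : Fin m) {ω : Matrix (R × (Fin m → ι)) (R × (Fin m → ι)) ℂ}
    (hω : IsDensityMatrix ω) : IsDensityMatrix (applyAt R k Φ ω) :=
  ⟨hΦ.applyAt_posSemidef k hω.1,
    (trace_applyAt (c := 1) (fun X => by rw [one_mul, hΦ.2]) k ω).trans (by rw [hω.2, one_mul])⟩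

theorem IsEffect.comp_applyAt {φ : Matrix (R × (Fin m → ι)) (R × (Fin m → ι)) ℂ →ₗ[ℂ] ℂ}
    (hφ : IsEffect φ) {Φ : Matrix ι ι ℂ →ₗ[ℂ] Matrix ι ι ℂ} (hΦ : IsChannel Φ) (k : Fin m) :
    IsEffect (φ ∘ₗ applyAt R k Φ) := by
  intro X hX
  have h := hφ _ (hΦ.applyAt_posSemidef k hX)
  rwa [trace_applyAt (c := 1) (fun X => by rw [one_mul, hΦ.2]), one_mul] at h

/-- The map `Φ` applied successively to the tensor factors in a list. -/
def applyList (S : Type*) (Φ : Matrix ι ι ℂ →ₗ[ℂ] Matrix ι ι ℂ) :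
    List (Fin m) → Matrix (S × (Fin m → ι)) (S × (Fin m → ι)) ℂ →ₗ[ℂ]
      Matrix (S × (Fin m → ι)) (S × (Fin m → ι)) ℂ
  | [] => LinearMap.id
  | k :: l => applyAt S k Φ ∘ₗ applyList S Φ l

theorem IsChannel.isDensityMatrix_applyList {Φ : Matrix ι ι ℂ →ₗ[ℂ] Matrix ι ι ℂ}
    (hΦ : IsChannel Φ) (l : List (Fin m)) {ω : Matrix (R × (Fin m → ι)) (R × (Fin m → ι)) ℂ}
    (hω : IsDensityMatrix ω) : IsDensityMatrix (applyList R Φ l ω) := by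
  induction l with
  | nil => exact hω
  | cons k l ih => exact hΦ.isDensityMatrix_applyAt k ih

/-- Hybrid argument: errors in diamond distance add up under parallel composition. -/
theorem IsEffect.re_sub_applyList_le [DecidableEq ι]
    {Φ Ψ : Matrix ι ι ℂ →ₗ[ℂ] Matrix ι ι ℂ}
    (hΦ : IsChannel Φ) (hΨ : IsChannel Ψ) {ε : ℝ} (hε : 0 ≤ ε)
    (h : diamondDist Φ Ψ ≤ ENNReal.ofReal ε)
    {ω : Matrix (R × (Fin m → ι)) (R × (Fin m → ι)) ℂ} (hω : IsDensityMatrix ω)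
    (l : List (Fin m)) {φ : Matrix (R × (Fin m → ι)) (R × (Fin m → ι)) ℂ →ₗ[ℂ] ℂ}
    (hφ : IsEffect φ) :
    |(φ (applyList R Φ l ω)).re - (φ (applyList R Ψ l ω)).re| ≤ l.length * ε := by
  induction l generalizing φ with
  | nil => simp [applyList]
  | cons k l ih =>
    -- Absorbing the head channel `Φ` into the effect leaves a comparison on the tail; `h2` then
    -- swaps the head, with the tail already replaced by `Ψ`.
    have h1 := ih (hφ.comp_applyAt hΦ k)
    have hst := (hΨ.isDensityMatrix_applyList l hω).submatrix_equiv (siteEquiv R ι k).symm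
    have h2 := (hφ.submatrix (siteEquiv R ι k)).re_sub_le_of_diamondDist_le hΦ hΨ hε h hst
    have h3 : |(φ (applyAt R k Φ (applyList R Ψ l ω))).re
        - (φ (applyAt R k Ψ (applyList R Ψ l ω))).re| ≤ ε := by
      rw [map_sub, Complex.sub_re] at h2
      exact h2
    simp only [LinearMap.comp_apply] at h1
    simp only [applyList, LinearMap.comp_apply, List.length_cons, Nat.cast_add, Nat.cast_one]
    rw [abs_le] at h1 h3 ⊢
    constructor <;> linarith [h1.1, h1.2, h3.1, h3.2]

/-- A product operator on the reference and the tensor factors. -/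
def refTensor (E : Matrix S S ℂ) (A : Fin m → Matrix ι ι ℂ) :
    Matrix (S × (Fin m → ι)) (S × (Fin m → ι)) ℂ := E ⊗ₖ tensorProd A

omit [Fintype ι] in
theorem tensorProd_apply_split (A : Fin m → Matrix ι ι ℂ) (k : Fin m) (f g : Fin m → ι) :
    tensorProd A f g = A k (f k) (g k) * ∏ j : {j // j ≠ k}, A j (f j) (g j) := by
  rw [tensorProd, Matrix.of_apply, Fintype.prod_eq_mul_prod_subtype_ne _ k]

omit [Fintype ι] in
theorem applyAt_refTensor (k : Fin m) (Φ : Matrix ι ι ℂ →ₗ[ℂ] Matrix ι ι ℂ)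
    (E : Matrix S S ℂ) (A : Fin m → Matrix ι ι ℂ) :
    applyAt S k Φ (refTensor E A) = refTensor E (Function.update A k (Φ (A k))) := by
  ext ⟨r, f⟩ ⟨s, g⟩
  have h : (Matrix.of fun i j => refTensor E A
        ((siteEquiv S ι k).symm ((r, fun j => f j.1), i))
        ((siteEquiv S ι k).symm ((s, fun j => g j.1), j)))
      = (E r s * ∏ j : {j // j ≠ k}, A j (f j) (g j)) • A k := by
    ext i j
    have hp : ∀ x : {j // j ≠ k}, (x : Fin m) ≠ k := fun x => x.2
    simp [refTensor, siteEquiv, tensorProd_apply_split A k, Equiv.funSplitAt, Equiv.piSplitAt, hp]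
    ring
  have h' : applyAt S k Φ (refTensor E A) (r, f) (s, g)
      = Φ (Matrix.of fun i j => refTensor E A
        ((siteEquiv S ι k).symm ((r, fun j => f j.1), i))
        ((siteEquiv S ι k).symm ((s, fun j => g j.1), j))) (f k) (g k) := rfl
  rw [h', h, map_smul]
  have hp : ∀ x : {j // j ≠ k}, (x : Fin m) ≠ k := fun x => x.2
  simp [refTensor, tensorProd_apply_split _ k, hp]
  ring

omit [Fintype ι] in
theorem applyList_refTensor (Φ : Matrix ι ι ℂ →ₗ[ℂ] Matrix ι ι ℂ) (E : Matrix S S ℂ)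
    (A : Fin m → Matrix ι ι ℂ) {l : List (Fin m)} (hl : l.Nodup) :
    applyList S Φ l (refTensor E A) = refTensor E fun k => if k ∈ l then Φ (A k) else A k := by
  induction l with
  | nil => simp [applyList]
  | cons k l ih =>
    rw [List.nodup_cons] at hl
    rw [applyList, LinearMap.comp_apply, ih hl.2, applyAt_refTensor]
    congr 1
    funext j
    by_cases hj : j = k
    · subst hj
      simp [hl.1]
    · simp [hj]

/-- Matrix units are product operators, and on those both sides act factor by factor. -/
theorem applyList_finRange [DecidableEq ι] (Φ : Matrix ι ι ℂ →ₗ[ℂ] Matrix ι ι ℂ)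
    (X : Matrix (R × (Fin m → ι)) (R × (Fin m → ι)) ℂ) :
    applyList R Φ (List.finRange m) X = idTensor R (channelPow Φ m) X := by
  classical
  suffices h : applyList R Φ (List.finRange m) = idTensor R (channelPow Φ m) by rw [h]
  refine Matrix.ext_linearMap ℂ fun ⟨r, f⟩ ⟨s, g⟩ => LinearMap.ext_ring ?_
  have hsingle : Matrix.single (r, f) (s, g) (1 : ℂ)
      = refTensor (Matrix.single r s 1) fun k => Matrix.single (f k) (g k) (1 : ℂ) := by
    ext ⟨r', f'⟩ ⟨s', g'⟩
    simp only [refTensor, Matrix.kroneckerMap_apply, tensorProd, Matrix.of_apply,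
      Matrix.single_apply, Finset.prod_ite_zero, Finset.prod_const_one, Prod.mk.injEq,
      Finset.mem_univ, true_implies, funext_iff, ite_mul, one_mul, zero_mul, forall_and]
    split_ifs <;> tauto
  simp only [LinearMap.comp_apply, Matrix.singleLinearMap_apply]
  rw [hsingle, applyList_refTensor _ _ _ (List.nodup_finRange m)]
  ext ⟨r', f'⟩ ⟨s', g'⟩
  have hblock : (Matrix.of fun k l => refTensor (Matrix.single r s (1 : ℂ))
        (fun k => Matrix.single (f k) (g k) (1 : ℂ)) (r', k) (s', l))
      = Matrix.single r s (1 : ℂ) r' s' • tensorProd fun k => Matrix.single (f k) (g k) (1 : ℂ) := by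
    ext; rfl
  simp only [idTensor, LinearMap.coe_mk, AddHom.coe_mk, Matrix.of_apply, hblock, map_smul,
    channelPow_tensorProd, List.mem_finRange, if_true]
  rfl

/-- Applying a processor with block-dependent program states preserves block positivity. -/
theorem IsChannel.blockPSD_applyAt {P : Matrix (ι × κ) (ι × κ) ℂ →ₗ[ℂ] Matrix ι ι ℂ}
    (hP : IsChannel P) (k : Fin m)
    {Z : Fin 2 → Fin 2 → Matrix (R × (Fin m → ι)) (R × (Fin m → ι)) ℂ} (hZ : BlockPSD Z)
    {T : Fin 2 → Fin 2 → Matrix κ κ ℂ} (hT : BlockPSD T) :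
    BlockPSD fun a b => applyAt R k (P ∘ₗ appendState (T a b)) (Z a b) := by
  -- Select from `Z ⊗ T` the entries whose two block indices agree. The common index then joins the
  -- reference, on which `P` does not act.
  have h := (hZ.kronecker hT).submatrix
    (fun x : (Fin 2 × (R × ({j // j ≠ k} → ι))) × (ι × κ) =>
      ((x.1.1, (siteEquiv R ι k).symm (x.1.2, x.2.1)), (x.1.1, x.2.2)))
  exact (hP.idTensor_posSemidef h).submatrix
    (fun x : Fin 2 × (R × (Fin m → ι)) =>
      ((x.1, (siteEquiv R ι k x.2).1), (siteEquiv R ι k x.2).2))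

theorem IsChannel.blockPSD_applyList {P : Matrix (ι × κ) (ι × κ) ℂ →ₗ[ℂ] Matrix ι ι ℂ}
    (hP : IsChannel P) (l : List (Fin m))
    {Z : Fin 2 → Fin 2 → Matrix (R × (Fin m → ι)) (R × (Fin m → ι)) ℂ} (hZ : BlockPSD Z)
    {T : Fin 2 → Fin 2 → Matrix κ κ ℂ} (hT : BlockPSD T) :
    BlockPSD fun a b => applyList R (P ∘ₗ appendState (T a b)) l (Z a b) := by
  induction l with
  | nil => exact hZ
  | cons k l ih => exact hP.blockPSD_applyAt k ih hT

theorem IsChannel.trace_comp_appendState {P : Matrix (ι × κ) (ι × κ) ℂ →ₗ[ℂ] Matrix ι ι ℂ}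
    (hP : IsChannel P) (τ : Matrix κ κ ℂ) (X : Matrix ι ι ℂ) :
    ((P ∘ₗ appendState τ) X).trace = τ.trace * X.trace := by
  rw [LinearMap.comp_apply, hP.2, mul_comm]
  exact Matrix.trace_kronecker X τ

theorem IsChannel.trace_applyList {P : Matrix (ι × κ) (ι × κ) ℂ →ₗ[ℂ] Matrix ι ι ℂ}
    (hP : IsChannel P) (τ : Matrix κ κ ℂ) (l : List (Fin m))
    (X : Matrix (R × (Fin m → ι)) (R × (Fin m → ι)) ℂ) :
    (applyList R (P ∘ₗ appendState τ) l X).trace = τ.trace ^ l.length * X.trace := by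
  induction l with
  | nil => simp [applyList]
  | cons k l ih =>
    rw [applyList, LinearMap.comp_apply, trace_applyAt (hP.trace_comp_appendState τ), ih,
      List.length_cons, pow_succ]
    ring

theorem IsChannel.comp_appendState {P : Matrix (ι × κ) (ι × κ) ℂ →ₗ[ℂ] Matrix ι ι ℂ}
    (hP : IsChannel P) {τ : Matrix κ κ ℂ} (hτ : IsDensityMatrix τ) :
    IsChannel (P ∘ₗ appendState τ) := by
  refine ⟨fun r X hX => ?_, fun X => by rw [hP.trace_comp_appendState, hτ.2, one_mul]⟩
  exact hP.1 r _ ((hX.kronecker hτ.1).submatrix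
    (fun x : Fin r × (ι × κ) => ((x.1, x.2.1), x.2.2)))

end Sites

/-! ### Tensor powers and the block matrix of the fidelity -/

theorem tensorProd_mul {μ : Type*} {n : ℕ} (A : Fin n → Matrix μ ι ℂ) (B : Fin n → Matrix ι μ ℂ) :
    (Matrix.of fun (f : Fin n → μ) (g : Fin n → ι) => ∏ k, A k (f k) (g k)) *
      (Matrix.of fun (f : Fin n → ι) (g : Fin n → μ) => ∏ k, B k (f k) (g k))
      = tensorProd fun k => A k * B k := by
  ext f g
  simp only [Matrix.mul_apply, Matrix.of_apply, tensorProd, ← Finset.prod_mul_distrib]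
  rw [Finset.prod_univ_sum, Fintype.piFinset_univ]

theorem tensorPow_posSemidef {A : Matrix ι ι ℂ} (hA : A.PosSemidef) (n : ℕ) :
    (tensorPow A n).PosSemidef := by
  classical
  have h : tensorPow A n = (tensorPow (msqrt A) n)ᴴ * tensorPow (msqrt A) n := by
    have h1 : (tensorPow (msqrt A) n)ᴴ = tensorPow (msqrt A) n := by
      ext f g
      simp only [tensorPow, tensorProd, Matrix.conjTranspose_apply, Matrix.of_apply, star_prod]
      exact Finset.prod_congr rfl fun k _ => (msqrt_posSemidef A).isHermitian.apply _ _
    rw [h1]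
    conv_lhs => rw [← msqrt_mul_self hA]
    exact (tensorProd_mul _ _).symm
  rw [h]
  exact Matrix.posSemidef_conjTranspose_mul_self _

theorem trace_tensorPow (A : Matrix ι ι ℂ) (n : ℕ) : (tensorPow A n).trace = A.trace ^ n := by
  classical
  simp only [Matrix.trace, Matrix.diag_apply, tensorPow, tensorProd, Matrix.of_apply]
  have h := Finset.prod_univ_sum (fun _ : Fin n => (Finset.univ : Finset ι)) fun _ i => A i i
  rw [Fintype.piFinset_univ] at h
  rw [← h, Finset.prod_const, Finset.card_univ, Fintype.card_fin]

theorem IsDensityMatrix.tensorPow {ρ : Matrix ι ι ℂ} (hρ : IsDensityMatrix ρ) (n : ℕ) :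
    IsDensityMatrix (tensorPow ρ n) :=
  ⟨tensorPow_posSemidef hρ.1 n, by rw [trace_tensorPow, hρ.2, one_pow]⟩

/-- The blocks form the principal submatrix of the full tensor power where all block indices
coincide. -/
theorem BlockPSD.tensorPow {T : Fin 2 → Fin 2 → Matrix ι ι ℂ} (hT : BlockPSD T) (n : ℕ) :
    BlockPSD fun a b => tensorPow (T a b) n :=
  (tensorPow_posSemidef hT n).submatrix (fun (x : Fin 2 × (Fin n → ι)) k => (x.1, x.2 k))

theorem blockPSD_conjTranspose_mul (V : Fin 2 → Matrix ι ι ℂ) :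
    BlockPSD fun a b => (V a)ᴴ * V b :=
  Matrix.posSemidef_conjTranspose_mul_self (Matrix.of fun i (x : Fin 2 × ι) => V x.1 i x.2)

/-- The root fidelity is the trace of an off-diagonal block completing `σ` and `ρ` to a positive
semidefinite block matrix. -/
theorem exists_blockPSD_trace_eq [DecidableEq ι] {ρ σ : Matrix ι ι ℂ}
    (hρ : ρ.PosSemidef) (hσ : σ.PosSemidef) :
    ∃ T : Fin 2 → Fin 2 → Matrix ι ι ℂ, BlockPSD T ∧ T 0 0 = σ ∧ T 1 1 = ρ ∧
      (T 0 1).trace = traceNorm (msqrt ρ * msqrt σ) := by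
  obtain ⟨U, hU, hUU⟩ := exists_partialIsometry_trace (msqrt ρ * msqrt σ)
  have hρs := (msqrt_posSemidef ρ).isHermitian.eq
  have hσs := (msqrt_posSemidef σ).isHermitian.eq
  -- `V` alone would give the lower block `√ρ U†U √ρ`, as `U` is only a partial isometry. `W`
  -- restores the missing part of `ρ`, and `W 0 = 0` leaves the other blocks unchanged.
  let V : Fin 2 → Matrix ι ι ℂ := ![msqrt σ, U * msqrt ρ]
  let W : Fin 2 → Matrix ι ι ℂ := ![0, (1 - Uᴴ * U) * msqrt ρ]
  refine ⟨fun a b => (V a)ᴴ * V b + (W a)ᴴ * W b,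
    (blockPSD_conjTranspose_mul V).add (blockPSD_conjTranspose_mul W), ?_, ?_, ?_⟩
  · simp [V, W, hσs, msqrt_mul_self hσ]
  · have h1 : (1 - Uᴴ * U) * (1 - Uᴴ * U) = 1 - Uᴴ * U := by
      simp [Matrix.sub_mul, Matrix.mul_sub, hUU]
    have h2 : (1 - Uᴴ * U)ᴴ = 1 - Uᴴ * U := by simp
    calc (V 1)ᴴ * V 1 + (W 1)ᴴ * W 1
        = msqrt ρ * (Uᴴ * U) * msqrt ρ
          + msqrt ρ * ((1 - Uᴴ * U) * (1 - Uᴴ * U)) * msqrt ρ := by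
          simp only [V, W, Matrix.cons_val_one, Matrix.cons_val_fin_one,
            Matrix.conjTranspose_mul, h2, hρs, Matrix.mul_assoc]
      _ = ρ := by
          rw [h1, Matrix.mul_sub, Matrix.sub_mul, Matrix.mul_one, msqrt_mul_self hρ]
          abel
  · simp only [V, W, Matrix.cons_val_zero, Matrix.cons_val_one, Matrix.cons_val_fin_one,
      Matrix.conjTranspose_zero, Matrix.zero_mul, add_zero, hσs]
    rw [← hU, ← Matrix.mul_assoc, Matrix.trace_mul_comm, ← Matrix.mul_assoc]

/-! ### The fidelity bound -/

theorem isChannel_idealChannel [DecidableEq ι] {ρ : Matrix ι ι ℂ} (hρ : ρ.IsHermitian) (t : ℝ) :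
    IsChannel (idealChannel ρ t) := by
  set V := NormedSpace.exp ((Complex.I * t) • ρ) with hV
  have hadj : NormedSpace.exp ((-(Complex.I * t)) • ρ) = Vᴴ := by
    rw [hV, ← Matrix.exp_conjTranspose, Matrix.conjTranspose_smul, hρ.eq]
    simp
  have hone : V * Vᴴ = 1 := by
    rw [← hadj, hV, ← Matrix.exp_add_of_commute _ _ (((Commute.refl ρ).smul_right _).smul_left _),
      ← add_smul, add_neg_cancel, zero_smul, NormedSpace.exp_zero]
  have happ : ∀ X, idealChannel ρ t X = Vᴴ * X * V := fun X => by rw [← hadj]; rfl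
  refine ⟨fun r X hX => ?_, fun X => ?_⟩
  · convert hX.conjTranspose_mul_mul_same ((1 : Matrix (Fin r) (Fin r) ℂ) ⊗ₖ V) using 1
    ext ⟨a, i⟩ ⟨b, j⟩
    simp [idTensor, happ, Matrix.mul_apply, Fintype.sum_prod_type, Matrix.one_apply,
      Finset.sum_mul, ite_mul, mul_ite, apply_ite star]
  · rw [happ, Matrix.trace_mul_comm, ← Matrix.mul_assoc, hone, Matrix.one_mul]

/-- The right side of `h` is the cosine of the angle between the unit vectors `(√q, √(1-q))` and
`(√p, √(1-p))`. Its sine is at least `p - q ≥ 1 - 2y`, and `1 - (1 - 2y)² = 4y(1 - y)`. -/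
theorem sq_le_of_le_sqrt_add_sqrt {s p q y : ℝ} (hs : 0 ≤ s) (hy : y ≤ 1 / 2)
    (hp : 1 - y ≤ p) (hp1 : p ≤ 1) (hq0 : 0 ≤ q) (hq : q ≤ y)
    (h : s ≤ √q * √p + √(1 - q) * √(1 - p)) : s ^ 2 ≤ 4 * y * (1 - y) := by
  have hp0 : 0 ≤ p := by linarith
  set a := √q
  set b := √p
  set c := √(1 - q)
  set e := √(1 - p)
  have ha : a ^ 2 = q := Real.sq_sqrt hq0
  have hb : b ^ 2 = p := Real.sq_sqrt hp0
  have hc : c ^ 2 = 1 - q := Real.sq_sqrt (by linarith)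
  have he : e ^ 2 = 1 - p := Real.sq_sqrt (by linarith)
  have hsq : s ^ 2 ≤ (a * b + c * e) ^ 2 := pow_le_pow_left₀ hs h 2
  -- the complementary quantity `b c - a e` is at least `1 - 2 y`
  have hsum : (a * b + c * e) ^ 2 + (b * c - a * e) ^ 2 = 1 := by
    have : (a * b + c * e) ^ 2 + (b * c - a * e) ^ 2 = (a ^ 2 + c ^ 2) * (b ^ 2 + e ^ 2) := by ring
    rw [this, ha, hb, hc, he]; ring
  have hprod : (b * c - a * e) * (b * c + a * e) = p - q := by
    have : (b * c - a * e) * (b * c + a * e) = b ^ 2 * c ^ 2 - a ^ 2 * e ^ 2 := by ring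
    rw [this, ha, hb, hc, he]; ring
  have hle1 : b * c + a * e ≤ 1 := by
    nlinarith [sq_nonneg (b - c), sq_nonneg (a - e)]
  have hdiff : 1 - 2 * y ≤ b * c - a * e := by
    have hae : a * e ≤ b * c := by
      rw [mul_comm b c]
      exact mul_le_mul (Real.sqrt_le_sqrt (by linarith)) (Real.sqrt_le_sqrt (by linarith))
        (Real.sqrt_nonneg _) (Real.sqrt_nonneg _)
    have := mul_le_of_le_one_right (sub_nonneg.mpr hae) hle1
    linarith
  nlinarith [pow_le_pow_left₀ (by linarith : (0:ℝ) ≤ 1 - 2 * y) hdiff 2]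

/-- If `P` simulates `U_ρ` and `U_σ` up to error `ε` from `n` samples, and `m` uses of `U_ρ` and
`U_σ` are perfectly distinguishable, then the fidelity of the programs is bounded. -/
theorem fidelity_pow_le [DecidableEq ι] {ρ σ : Matrix ι ι ℂ} (hρ : IsDensityMatrix ρ)
    (hσ : IsDensityMatrix σ) {t ε : ℝ} (hε : 0 ≤ ε) {m n : ℕ} (hm : m * ε < 1 / 2)
    (hdist : diamondDist (channelPow (idealChannel ρ t) m) (channelPow (idealChannel σ t) m) = 1)
    {P : Matrix (ι × (Fin n → ι)) (ι × (Fin n → ι)) ℂ →ₗ[ℂ] Matrix ι ι ℂ} (hP : IsChannel P)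
    (hPρ : diamondDist (P ∘ₗ appendState (tensorPow ρ n)) (idealChannel ρ t) ≤ ENNReal.ofReal ε)
    (hPσ : diamondDist (P ∘ₗ appendState (tensorPow σ n)) (idealChannel σ t)
      ≤ ENNReal.ofReal ε) :
    fidelity ρ σ ^ (n * m) ≤ 4 * (m * ε) * (1 - m * ε) := by
  have hUρ := isChannel_idealChannel hρ.1.isHermitian t
  have hUσ := isChannel_idealChannel hσ.1.isHermitian t
  -- The supremum in the diamond distance need not be known to be attained, so a slack `δ` is kept
  -- and sent to `0` at the end.
  have main : ∀ δ : ℝ, 0 < δ → δ ≤ 1 / 2 - m * ε →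
      fidelity ρ σ ^ (n * m) ≤ 4 * (m * ε + δ) * (1 - (m * ε + δ)) := by
    intro δ hδ hδ2
    have hlt : ENNReal.ofReal (1 - δ) < diamondDist (channelPow (idealChannel ρ t) m)
        (channelPow (idealChannel σ t) m) := by
      rw [hdist, ENNReal.ofReal_lt_one]
      linarith
    rw [diamondDist] at hlt
    simp only [lt_iSup_iff] at hlt
    obtain ⟨r, ω, hω, hlt⟩ := hlt
    have hδ1 : 1 - δ < _ := ((ENNReal.ofReal_lt_ofReal_iff_of_nonneg (by
      have : 0 ≤ m * ε := by positivity
      linarith)).mp hlt)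
    simp only [← applyList_finRange] at hδ1
    set l := List.finRange m with hl
    have hA := hUρ.isDensityMatrix_applyList l hω
    have hB := hUσ.isDensityMatrix_applyList l hω
    obtain ⟨φ, hφ, hval⟩ := exists_isEffect_re_eq_traceNorm
      (hA.1.isHermitian.sub hB.1.isHermitian)
      (by rw [Matrix.trace_sub, hA.2, hB.2, sub_self])
    rw [← hval, map_sub, Complex.sub_re] at hδ1
    have hφA := (Complex.le_def.mp (hφ _ hA.1).2).1
    have hφB := (Complex.le_def.mp (hφ _ hB.1).1).1
    rw [hA.2, Complex.one_re] at hφA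
    rw [Complex.zero_re] at hφB
    have hNρ := hP.comp_appendState (hρ.tensorPow n)
    have hNσ := hP.comp_appendState (hσ.tensorPow n)
    have hρd := hφ.re_sub_applyList_le hNρ hUρ hε hPρ hω l
    have hσd := hφ.re_sub_applyList_le hNσ hUσ hε hPσ hω l
    rw [hl, List.length_finRange, ← hl] at hρd hσd
    rw [abs_le] at hρd hσd
    obtain ⟨T, hT, hT0, hT1, hTtr⟩ := exists_blockPSD_trace_eq hρ.1 hσ.1
    have hZ := hP.blockPSD_applyList l (blockPSD_const hω.1) (hT.tensorPow n)
    have hA' := hNρ.isDensityMatrix_applyList l hω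
    have hB' := hNσ.isDensityMatrix_applyList l hω
    have h1 := hZ.norm_map_le fun X hX => (hφ X hX).1
    -- Cauchy–Schwarz for the complementary outcome; the two functionals add up to the trace.
    have h2 := hZ.norm_map_le (φ := Matrix.traceLinearMap _ ℂ ℂ - φ)
      fun X hX => sub_nonneg.mpr (hφ X hX).2
    have htr := hP.trace_applyList (tensorPow (T 0 1) n) l ω
    rw [trace_tensorPow, hTtr, hω.2, mul_one, ← pow_mul, hl, List.length_finRange, ← hl] at htr
    simp only [hT0, hT1, LinearMap.sub_apply, Matrix.traceLinearMap_apply, Complex.sub_re,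
      hA'.2, hB'.2, Complex.one_re] at h1 h2
    have hs0 : 0 ≤ traceNorm (msqrt ρ * msqrt σ) :=
      (Complex.nonneg_iff.mp (msqrt_posSemidef _).trace_nonneg).1
    have hs : traceNorm (msqrt ρ * msqrt σ) ^ (n * m)
        ≤ ‖φ (applyList (Fin r) (P ∘ₗ appendState (tensorPow (T 0 1) n)) l ω)‖
          + ‖(applyList (Fin r) (P ∘ₗ appendState (tensorPow (T 0 1) n)) l ω).trace
            - φ (applyList (Fin r) (P ∘ₗ appendState (tensorPow (T 0 1) n)) l ω)‖ := by
      refine le_trans ?_ (norm_add_le _ _)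
      rw [add_sub_cancel, htr, ← Complex.ofReal_pow, Complex.norm_real, Real.norm_eq_abs]
      exact le_abs_self _
    have hp1 := (Complex.le_def.mp (hφ _ hA'.1).2).1
    have hq0 := (Complex.le_def.mp (hφ _ hB'.1).1).1
    rw [hA'.2, Complex.one_re] at hp1
    rw [Complex.zero_re] at hq0
    have hfin := sq_le_of_le_sqrt_add_sqrt (y := m * ε + δ) (pow_nonneg hs0 _) (by linarith)
      (by linarith [hρd.1]) hp1 hq0 (by linarith [hσd.2]) (hs.trans (add_le_add h1 h2))
    rwa [fidelity, ← pow_mul, mul_comm 2, pow_mul]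
  have hlim : Filter.Tendsto (fun δ : ℝ => 4 * (m * ε + δ) * (1 - (m * ε + δ)))
      (nhdsWithin 0 (Set.Ioi 0)) (nhds (4 * (m * ε) * (1 - m * ε))) := by
    have : Continuous fun δ : ℝ => 4 * (m * ε + δ) * (1 - (m * ε + δ)) := by fun_prop
    simpa using (this.tendsto 0).mono_left nhdsWithin_le_nhds
  refine ge_of_tendsto hlim ?_
  filter_upwards [Ioc_mem_nhdsGT (show (0 : ℝ) < 1 / 2 - m * ε by linarith)] with δ hδ
  exact main δ hδ.1 hδ.2

/-! ### Passage to extended reals -/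

theorem iInf_natCast_eq_top_or (p : ℕ → Prop) :
    (⨅ (n : ℕ) (_ : p n), (n : ℕ∞)) = ⊤ ∨ ∃ n, p n ∧ (⨅ (n : ℕ) (_ : p n), (n : ℕ∞)) = n := by
  classical
  by_cases h : ∃ n, p n
  · refine Or.inr ⟨Nat.find h, Nat.find_spec h, le_antisymm (iInf₂_le _ (Nat.find_spec h)) ?_⟩
    exact le_iInf₂ fun n hn => Nat.cast_le.mpr (Nat.find_min' h hn)
  · push Not at h
    exact Or.inl (by simp [h])

theorem sampleComplexity_eq_top_or (d : ℕ) (t ε : ℝ) :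
    sampleComplexity d t ε = ⊤ ∨ ∃ n : ℕ,
      (∃ P : Matrix (Fin d × (Fin n → Fin d)) (Fin d × (Fin n → Fin d)) ℂ →ₗ[ℂ]
        Matrix (Fin d) (Fin d) ℂ,
        IsChannel P ∧ ∀ κ : Matrix (Fin d) (Fin d) ℂ, IsDensityMatrix κ →
          diamondDist (P ∘ₗ appendState (tensorPow κ n)) (idealChannel κ t)
            ≤ ENNReal.ofReal ε) ∧
      sampleComplexity d t ε = n :=
  iInf_natCast_eq_top_or _

theorem zeroErrorQueryComplexity_eq_top_or {d : ℕ} (ρ σ : Matrix (Fin d) (Fin d) ℂ) (t : ℝ) :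
    zeroErrorQueryComplexity ρ σ t = ⊤ ∨ ∃ m : ℕ,
      diamondDist (channelPow (idealChannel ρ t) m) (channelPow (idealChannel σ t) m) = 1 ∧
      zeroErrorQueryComplexity ρ σ t = m :=
  iInf_natCast_eq_top_or _

/-- The degenerate cases `m = 0`, `F = 0` and `F ≥ 1` make the quotient zero or nonpositive. At `x =
1/2` no hypothesis on powers is needed, since `4x(1 - x) = 1`. -/
theorem neg_log_div_le {F x : ℝ} {m n : ℕ} (hF0 : 0 ≤ F) (hx0 : 0 ≤ x) (hx : x ≤ 1 / 2)
    (h : x < 1 / 2 → F ^ (n * m) ≤ 4 * x * (1 - x)) :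
    -ENNReal.log (ENNReal.ofReal (4 * x * (1 - x))) /
        ((m : EReal) * (-ENNReal.log (ENNReal.ofReal F))) ≤ (n : EReal) := by
  have hle1 : 4 * x * (1 - x) ≤ 1 := by nlinarith [sq_nonneg (1 - 2 * x)]
  have hn : (0 : EReal) ≤ n := Nat.cast_nonneg' n
  have hnum : 0 ≤ -ENNReal.log (ENNReal.ofReal (4 * x * (1 - x))) := by
    rw [EReal.neg_nonneg, ← ENNReal.log_one]
    exact ENNReal.log_monotone (ENNReal.ofReal_le_one.mpr hle1)
  rcases Nat.eq_zero_or_pos m with rfl | hm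
  · simp
  rcases hF0.eq_or_lt with rfl | hF
  · rw [ENNReal.ofReal_zero, ENNReal.log_zero, EReal.neg_bot,
      EReal.mul_top_of_pos (by exact_mod_cast hm), EReal.div_top]
    exact hn
  rcases le_or_gt 1 F with hF1 | hF1
  · refine (EReal.div_nonpos_of_nonneg_of_nonpos hnum ?_).trans hn
    refine EReal.mul_nonpos_iff.mpr (Or.inl ⟨Nat.cast_nonneg' m, ?_⟩)
    rw [EReal.neg_le, neg_zero, ← ENNReal.log_one]
    exact ENNReal.log_monotone (ENNReal.one_le_ofReal.mpr hF1)
  have h' : F ^ (n * m) ≤ 4 * x * (1 - x) := by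
    rcases hx.eq_or_lt with rfl | hlt
    · exact (pow_le_one₀ hF0 hF1.le).trans (by norm_num)
    · exact h hlt
  have hpos : 0 < 4 * x * (1 - x) := (pow_pos hF _).trans_le h'
  have hlogF := Real.log_neg hF hF1
  rw [ENNReal.log_ofReal, ENNReal.log_ofReal, if_neg hpos.not_ge, if_neg hF.not_ge]
  have hden : (m : EReal) * -(Real.log F : EReal) = ((m * -Real.log F : ℝ) : EReal) := by
    push_cast; rfl
  have hmpos : (0 : ℝ) < m := by exact_mod_cast hm
  rw [hden, EReal.div_le_iff_le_mul (by
    exact_mod_cast mul_pos hmpos (neg_pos.mpr hlogF)) (EReal.coe_ne_top _)]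
  have hreal : -Real.log (4 * x * (1 - x)) ≤ m * -Real.log F * n := by
    have := Real.log_le_log (pow_pos hF _) h'
    rw [Real.log_pow] at this
    push_cast at this
    linarith
  exact_mod_cast hreal

end SampleSim

end

/-- The inequality is one between extended reals, with `-log 0 = ⊤`, `x / ⊤ = 0` and
`0 * ⊤ = 0`. -/
theorem mainTheorem6 (d : ℕ) (ρ σ : Matrix (Fin d) (Fin d) ℂ)
    (hρ : SampleSim.IsDensityMatrix ρ) (hσ : SampleSim.IsDensityMatrix σ) (hne : ρ ≠ σ)
    (t ε : ℝ) (ht : 0 ≤ t) (hε : 0 ≤ ε)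
    (hm : (SampleSim.zeroErrorQueryComplexity ρ σ t : ℝ≥0∞) * ENNReal.ofReal ε ≤ 1 / 2) :
    -ENNReal.log (4 * ((SampleSim.zeroErrorQueryComplexity ρ σ t : ℝ≥0∞) * ENNReal.ofReal ε) *
          (1 - (SampleSim.zeroErrorQueryComplexity ρ σ t : ℝ≥0∞) * ENNReal.ofReal ε)) /
        (((SampleSim.zeroErrorQueryComplexity ρ σ t : ℝ≥0∞) : EReal) *
          (-ENNReal.log (ENNReal.ofReal (SampleSim.fidelity ρ σ)))) ≤
      ((SampleSim.sampleComplexity d t ε : ℝ≥0∞) : EReal) := by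
  have hF0 : 0 ≤ SampleSim.fidelity ρ σ := sq_nonneg _
  rcases SampleSim.sampleComplexity_eq_top_or d t ε with hn | ⟨n, ⟨P, hP, hPκ⟩, hn⟩
  · rw [hn]
    simp
  rcases SampleSim.zeroErrorQueryComplexity_eq_top_or ρ σ t with hmm | ⟨m, hdist, hmm⟩ <;>
    rw [hmm] at hm ⊢ <;> rw [hn]
  · rw [ENat.toENNReal_top, EReal.coe_ennreal_top]
    -- With infinite query complexity the denominator is `⊥`, `0` or `⊤`, and division by each of
    -- these yields `0`.
    rcases lt_trichotomy (-ENNReal.log (ENNReal.ofReal (SampleSim.fidelity ρ σ))) 0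
      with h | h | h
    · rw [EReal.top_mul_of_neg h, EReal.div_bot]
      exact EReal.coe_ennreal_nonneg _
    · rw [h, mul_zero, EReal.div_zero]
      exact EReal.coe_ennreal_nonneg _
    · rw [EReal.top_mul_of_pos h, EReal.div_top]
      exact EReal.coe_ennreal_nonneg _
  have hx0 : 0 ≤ m * ε := by positivity
  have hcast : ((m : ℕ∞) : ℝ≥0∞) * ENNReal.ofReal ε = ENNReal.ofReal (m * ε) := by
    rw [ENNReal.ofReal_mul (Nat.cast_nonneg m), ENNReal.ofReal_natCast, ENat.toENNReal_coe]
  have hx : m * ε ≤ 1 / 2 := by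
    rw [hcast, ← ENNReal.ofReal_one, ← ENNReal.ofReal_ofNat 2,
      ← ENNReal.ofReal_div_of_pos (by norm_num)] at hm
    exact (ENNReal.ofReal_le_ofReal_iff (by norm_num)).mp hm
  have hlog : 4 * (((m : ℕ∞) : ℝ≥0∞) * ENNReal.ofReal ε) *
      (1 - ((m : ℕ∞) : ℝ≥0∞) * ENNReal.ofReal ε)
      = ENNReal.ofReal (4 * (m * ε) * (1 - m * ε)) := by
    rw [hcast, ENNReal.ofReal_mul (mul_nonneg zero_le_four hx0),
      ENNReal.ofReal_mul (p := 4) zero_le_four, ENNReal.ofReal_sub _ hx0, ENNReal.ofReal_one, ENNReal.ofReal_ofNat]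
  have hnat : ∀ k : ℕ, (((k : ℕ∞) : ℝ≥0∞) : EReal) = (k : EReal) := fun k => by
    rw [ENat.toENNReal_coe, ← ENNReal.ofReal_natCast, EReal.coe_ennreal_ofReal,
      max_eq_left (Nat.cast_nonneg k), EReal.coe_natCast]
  rw [hlog, hnat, hnat]
  exact SampleSim.neg_log_div_le (m := m) (n := n) hF0 hx0 hx fun hlt =>
    SampleSim.fidelity_pow_le hρ hσ hε hlt hdist hP (hPκ ρ hρ) (hPκ σ hσ)
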